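/- Let $I\subseteq\mathbb{R}$ be a nonempty open interval. A function $E:I^2\to\mathbb{R}$ is called a \emph{quasideviation} if (D1) $\operatorname{sign}E(x,u)=\operatorname{sign}(x-u)$ for all $x,u\in I$; (D2) for every $x\in I$ the map $I\ni u\mapsto E(x,u)$ is continuous; (D3) for all $x,y\in I$ with $x<y$ the map $(x,y)\ni u\mapsto E(x,u)/E(y,u)$ is strictly decreasing. For $n\ge 1$ and $x_1,\dots,x_n\in I$, the \emph{quasideviation mean} $\mathscr{D}_E(x_1,\dots,x_n)$ is the unique $u\in I$ with $E(x_1,u)+\dots+E(x_n,u)=0$. The mean $\mathscr{D}_E$ is called \emph{Jensen convex} if, for all $n\ge1$ and all $x,y\in I^n$, $\mathscr{D}_E\big(\frac{x+y}{2}\big)\le\frac{\mathscr{D}_E(x)+\mathscr{D}_E(y)}{2}$. Denote by $\partial_1^+E(u,u)$ and $\partial_1^-E(u,u)$ the (finite) right and left derivative, respectively, of $x\mapsto E(x,u)$ at $x=u$, when it exists. \textbf{Theorem.} Let $E:I^2\to\mathbb{R}$ be a quasideviation. Then the following conditions are equivalent: (i) The quasideviation mean $\mathscr{D}_E$ is Jensen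 convex. (ii) For all $u\in I$, the map $x\mapsto E(x,u)$ has a positive right derivative $\partial_1^+E(u,u)$ at $x=u$, and the function $E^+(x,u):=\frac{E(x,u)}{\partial_1^+E(u,u)}$ is convex on $I^2$. (iii) For all $u\in I$, the map $x\mapsto E(x,u)$ has a positive left derivative $\partial_1^-E(u,u)$ at $x=u$, and the function $E^-(x,u):=\frac{E(x,u)}{\partial_1^-E(u,u)}$ is convex on $I^2$. Moreover, if any of these equivalent conditions is satisfied, then: (a) $E$ is continuous on $I^2$. (b) For all $u\in I$, the function $I\ni x\mapsto E(x,u)$ is convex. (c) The function $I\ni u\mapsto(\partial_1^-E(u,u),\partial_1^+E(u,u))$ is continuous. (d) The map $I\ni u\mapsto\frac{\partial_1^+E(u,u)}{\partial_1^-E(u,u)}$ is constant. (e) $\mathscr{D}_E(x_1,\dots,x_n)\ge\frac{x_1+\dots+x_n}{n}$ for all $n\ge1$ and $x_1,\dots,x_n\in I$. -/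

import Mathlib

open Set

/-- A quasideviation on `I × I`. Functions on `I × I` are represented by functions on `ℝ × ℝ` of
which only the values at points of `I × I` are relevant. -/
structure IsQuasideviation (I : Set ℝ) (E : ℝ → ℝ → ℝ) : Prop where
  sign_eq : ∀ x ∈ I, ∀ u ∈ I, SignType.sign (E x u) = SignType.sign (x - u)
  continuousOn : ∀ x ∈ I, ContinuousOn (fun u => E x u) I
  strictAntiOn : ∀ x ∈ I, ∀ y ∈ I, x < y → StrictAntiOn (fun u => E x u / E y u) (Ioo x y)

/-- The `E`-quasideviation mean of `x₁, …, xₙ ∈ I`: the solution `u ∈ I` of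
`E(x₁, u) + ⋯ + E(xₙ, u) = 0`. It exists and is unique for a quasideviation and `n ≥ 1`, see
`IsQuasideviation.existsUnique` below. -/
noncomputable def quasideviationMean (I : Set ℝ) (E : ℝ → ℝ → ℝ) (n : ℕ) (x : Fin n → ℝ) : ℝ :=
  Classical.epsilon fun u => u ∈ I ∧ ∑ i, E (x i) u = 0

/-- Jensen convexity of a mean `M : ⋃ₙ Iⁿ → I`: every restriction of `M` to `Iⁿ`, `n ≥ 1`, is
Jensen convex. -/
def IsJensenConvexMean (I : Set ℝ) (M : (n : ℕ) → (Fin n → ℝ) → ℝ) : Prop :=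
  ∀ n : ℕ, 1 ≤ n → ∀ x y : Fin n → ℝ, (∀ i, x i ∈ I) → (∀ i, y i ∈ I) →
    M n (fun i => (x i + y i) / 2) ≤ (M n x + M n y) / 2

/-- The right partial derivative `∂₁⁺E(u, u)`. -/
noncomputable def rightDiagDeriv (E : ℝ → ℝ → ℝ) (u : ℝ) : ℝ :=
  derivWithin (fun x => E x u) (Ioi u) u

/-- The left partial derivative `∂₁⁻E(u, u)`. -/
noncomputable def leftDiagDeriv (E : ℝ → ℝ → ℝ) (u : ℝ) : ℝ :=
  derivWithin (fun x => E x u) (Iio u) u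

/-- For all `u ∈ I` the map `x ↦ E(x, u)` has a positive (finite) right derivative at `u`, and
`E⁺(x, u) = E(x, u) / ∂₁⁺E(u, u)` is convex on `I × I`. -/
def RightNormalizationConvex (I : Set ℝ) (E : ℝ → ℝ → ℝ) : Prop :=
  (∀ u ∈ I, DifferentiableWithinAt ℝ (fun x => E x u) (Ioi u) u ∧ 0 < rightDiagDeriv E u) ∧
    ConvexOn ℝ (I ×ˢ I) (fun p : ℝ × ℝ => E p.1 p.2 / rightDiagDeriv E p.2)

/-- For all `u ∈ I` the map `x ↦ E(x, u)` has a positive (finite) left derivative at `u`, and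
`E⁻(x, u) = E(x, u) / ∂₁⁻E(u, u)` is convex on `I × I`. -/
def LeftNormalizationConvex (I : Set ℝ) (E : ℝ → ℝ → ℝ) : Prop :=
  (∀ u ∈ I, DifferentiableWithinAt ℝ (fun x => E x u) (Iio u) u ∧ 0 < leftDiagDeriv E u) ∧
    ConvexOn ℝ (I ×ˢ I) (fun p : ℝ × ℝ => E p.1 p.2 / leftDiagDeriv E p.2)

namespace IsQuasideviation

variable {I : Set ℝ} {E : ℝ → ℝ → ℝ}

theorem pos (hE : IsQuasideviation I E) {x u : ℝ} (hx : x ∈ I) (hu : u ∈ I) (h : u < x) :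
    0 < E x u := by
  have := hE.sign_eq x hx u hu
  rwa [sign_pos (sub_pos.2 h), sign_eq_one_iff] at this

theorem neg (hE : IsQuasideviation I E) {x u : ℝ} (hx : x ∈ I) (hu : u ∈ I) (h : x < u) :
    E x u < 0 := by
  have := hE.sign_eq x hx u hu
  rwa [sign_neg (sub_neg.2 h), sign_eq_neg_one_iff] at this

theorem diag (hE : IsQuasideviation I E) {u : ℝ} (hu : u ∈ I) : E u u = 0 := by
  have := hE.sign_eq u hu u hu
  rwa [sub_self, sign_zero, sign_eq_zero_iff] at this

theorem nonneg (hE : IsQuasideviation I E) {x u : ℝ} (hx : x ∈ I) (hu : u ∈ I) (h : u ≤ x) :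
    0 ≤ E x u := by
  rcases h.eq_or_lt with rfl | h
  · exact (hE.diag hu).ge
  · exact (hE.pos hx hu h).le

theorem nonpos (hE : IsQuasideviation I E) {x u : ℝ} (hx : x ∈ I) (hu : u ∈ I) (h : x ≤ u) :
    E x u ≤ 0 := by
  rcases h.eq_or_lt with rfl | h
  · exact (hE.diag hu).le
  · exact (hE.neg hx hu h).le

theorem cross_lt (hE : IsQuasideviation I E) {x y u v : ℝ} (hx : x ∈ I) (hy : y ∈ I)
    (hu : u ∈ I) (hv : v ∈ I) (hxu : x < u) (huv : u < v) (hvy : v < y) :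
    E x v * E y u < E x u * E y v := by
  have h := hE.strictAntiOn x hx y hy (hxu.trans (huv.trans hvy))
    ⟨hxu, huv.trans hvy⟩ ⟨hxu.trans huv, hvy⟩ huv
  exact (div_lt_div_iff₀ (hE.pos hy hv hvy) (hE.pos hy hu (huv.trans hvy))).1 h

theorem cross_le (hE : IsQuasideviation I E) {x y u v : ℝ} (hx : x ∈ I) (hy : y ∈ I)
    (hu : u ∈ I) (hv : v ∈ I) (hxu : x ≤ u) (huv : u < v) (hvy : v ≤ y) :
    E x v * E y u ≤ E x u * E y v := by
  rcases hxu.eq_or_lt with rfl | hxu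
  · rw [hE.diag hu, zero_mul]
    exact mul_nonpos_of_nonpos_of_nonneg (hE.nonpos hx hv huv.le)
      (hE.nonneg hy hu (huv.le.trans hvy))
  rcases hvy.eq_or_lt with rfl | hvy
  · rw [hE.diag hv, mul_zero]
    exact mul_nonpos_of_nonpos_of_nonneg (hE.nonpos hx hv (hxu.le.trans huv.le))
      (hE.nonneg hv hu huv.le)
  exact (hE.cross_lt hx hy hu hv hxu huv hvy).le

theorem not_two_zeros (hE : IsQuasideviation I E) {n : ℕ} (hn : 1 ≤ n) {x : Fin n → ℝ}
    (hx : ∀ i, x i ∈ I) {u v : ℝ} (hu : u ∈ I) (hv : v ∈ I)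
    (hFu : ∑ i, E (x i) u = 0) (hFv : ∑ i, E (x i) v = 0) (huv : u < v) : False := by
  have i₀ : Fin n := ⟨0, hn⟩
  have hlow : ∃ i, x i < u := by
    by_contra! h
    have h0 := (Finset.sum_eq_zero_iff_of_nonneg
      (fun i _ => hE.nonneg (hx i) hu (h i))).1 hFu
    have hall : ∀ i, x i < v := fun i => by
      rcases (h i).eq_or_lt with h' | h'
      · exact h' ▸ huv
      · exact absurd (h0 i (Finset.mem_univ i)) (hE.pos (hx i) hu h').ne'
    have : ∑ i, E (x i) v < 0 :=
      Finset.sum_neg (fun i _ => hE.neg (hx i) hv (hall i)) ⟨i₀, Finset.mem_univ _⟩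
    exact this.ne hFv
  have hhigh : ∃ i, v < x i := by
    by_contra! h
    have h0 := (Finset.sum_eq_zero_iff_of_nonpos
      (fun i _ => hE.nonpos (hx i) hv (h i))).1 hFv
    have hall : ∀ i, u < x i := fun i => by
      rcases (h i).eq_or_lt with h' | h'
      · exact h' ▸ huv
      · exact absurd (h0 i (Finset.mem_univ i)) (hE.neg (hx i) hv h').ne
    have : 0 < ∑ i, E (x i) u :=
      Finset.sum_pos (fun i _ => hE.pos (hx i) hu (hall i)) ⟨i₀, Finset.mem_univ _⟩
    exact this.ne' hFu
  obtain ⟨i, hi⟩ := hlow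
  obtain ⟨j, hj⟩ := hhigh
  classical
  set A := Finset.univ.filter fun k => x k ≤ u
  set B := Finset.univ.filter fun k => v ≤ x k
  have hA : ∀ k ∈ A, x k ≤ u := fun k hk => (Finset.mem_filter.1 hk).2
  have hB : ∀ k ∈ B, v ≤ x k := fun k hk => (Finset.mem_filter.1 hk).2
  have hiA : i ∈ A := Finset.mem_filter.2 ⟨Finset.mem_univ _, hi.le⟩
  have hjB : j ∈ B := Finset.mem_filter.2 ⟨Finset.mem_univ _, hj.le⟩
  have hdisj : Disjoint A B := Finset.disjoint_left.2 fun k hk hk' =>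
    absurd ((hB k hk').trans (hA k hk)) (not_le.2 huv)
  have hsplit : ∀ w, ∑ k, E (x k) w =
      (∑ k ∈ A, E (x k) w + ∑ k ∈ B, E (x k) w) + ∑ k ∈ (A ∪ B)ᶜ, E (x k) w := fun w => by
    rw [← Finset.sum_union hdisj, Finset.sum_add_sum_compl]
  have hM : ∀ k ∈ (A ∪ B)ᶜ, u < x k ∧ x k < v := fun k hk => by
    rw [Finset.mem_compl, Finset.mem_union, not_or] at hk
    exact ⟨not_le.1 fun h => hk.1 (Finset.mem_filter.2 ⟨Finset.mem_univ _, h⟩),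
      not_le.1 fun h => hk.2 (Finset.mem_filter.2 ⟨Finset.mem_univ _, h⟩)⟩
  have hMu : 0 ≤ ∑ k ∈ (A ∪ B)ᶜ, E (x k) u :=
    Finset.sum_nonneg fun k hk => hE.nonneg (hx k) hu (hM k hk).1.le
  have hMv : ∑ k ∈ (A ∪ B)ᶜ, E (x k) v ≤ 0 :=
    Finset.sum_nonpos fun k hk => hE.nonpos (hx k) hv (hM k hk).2.le
  have hBu : 0 ≤ ∑ k ∈ B, E (x k) u :=
    Finset.sum_nonneg fun k hk => hE.nonneg (hx k) hu (huv.le.trans (hB k hk))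
  have hBv : 0 ≤ ∑ k ∈ B, E (x k) v :=
    Finset.sum_nonneg fun k hk => hE.nonneg (hx k) hv (hB k hk)
  have hcross : (∑ k ∈ A, E (x k) v) * (∑ k ∈ B, E (x k) u) <
      (∑ k ∈ A, E (x k) u) * (∑ k ∈ B, E (x k) v) := by
    rw [Finset.sum_mul_sum, Finset.sum_mul_sum]
    refine Finset.sum_lt_sum (fun k hk => Finset.sum_le_sum fun l hl =>
      hE.cross_le (hx k) (hx l) hu hv (hA k hk) huv (hB l hl)) ⟨i, hiA, ?_⟩
    exact Finset.sum_lt_sum (fun l hl => hE.cross_le (hx i) (hx l) hu hv hi.le huv (hB l hl))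
      ⟨j, hjB, hE.cross_lt (hx i) (hx j) hu hv hi huv hj⟩
  have h1 := hsplit u
  have h2 := hsplit v
  rw [hFu] at h1
  rw [hFv] at h2
  have h3 : ∑ k ∈ A, E (x k) u = -∑ k ∈ B, E (x k) u - ∑ k ∈ (A ∪ B)ᶜ, E (x k) u := by linarith
  have h4 : ∑ k ∈ A, E (x k) v = -∑ k ∈ B, E (x k) v - ∑ k ∈ (A ∪ B)ᶜ, E (x k) v := by linarith
  rw [h3, h4] at hcross
  nlinarith [mul_nonneg hBu (neg_nonneg.2 hMv), mul_nonneg hBv hMu]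

/-- The defining equation of the quasideviation mean has exactly one solution in `I`. -/
theorem existsUnique (hI : I.OrdConnected) (hE : IsQuasideviation I E) {n : ℕ} (hn : 1 ≤ n)
    {x : Fin n → ℝ} (hx : ∀ i, x i ∈ I) : ∃! u, u ∈ I ∧ ∑ i, E (x i) u = 0 := by
  have : Nonempty (Fin n) := ⟨⟨0, hn⟩⟩
  obtain ⟨a, ha⟩ := Finite.exists_min x
  obtain ⟨b, hb⟩ := Finite.exists_max x
  have hsub : Icc (x a) (x b) ⊆ I := hI.out (hx a) (hx b)
  have hcont : ContinuousOn (fun u => ∑ i, E (x i) u) (Icc (x a) (x b)) :=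
    continuousOn_finsetSum _ fun i _ => (hE.continuousOn (x i) (hx i)).mono hsub
  have h0 : (0 : ℝ) ∈ Icc (∑ i, E (x i) (x b)) (∑ i, E (x i) (x a)) :=
    ⟨Finset.sum_nonpos fun i _ => hE.nonpos (hx i) (hx b) (hb i),
      Finset.sum_nonneg fun i _ => hE.nonneg (hx i) (hx a) (ha i)⟩
  obtain ⟨u, hu, hFu⟩ := intermediate_value_Icc' (ha b) hcont h0
  refine ⟨u, ⟨hsub hu, hFu⟩, fun v ⟨hv, hFv⟩ => ?_⟩
  rcases lt_trichotomy u v with h | h | h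
  · exact (hE.not_two_zeros hn hx (hsub hu) hv hFu hFv h).elim
  · exact h.symm
  · exact (hE.not_two_zeros hn hx hv (hsub hu) hFv hFu h).elim

theorem mean_spec (hI : I.OrdConnected) (hE : IsQuasideviation I E) {n : ℕ} (hn : 1 ≤ n)
    {x : Fin n → ℝ} (hx : ∀ i, x i ∈ I) :
    quasideviationMean I E n x ∈ I ∧ ∑ i, E (x i) (quasideviationMean I E n x) = 0 :=
  Classical.epsilon_spec (hE.existsUnique hI hn hx).exists

end IsQuasideviation

/-! Since E(x₁, ·) + ⋯ + E(xₙ, ·) changes sign exactly once, the mean is ≤ w iff this sum is ≤ 0 at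
w (`mean_le_iff`). Jensen convexity thus says: two sums nonpositive at u and at v force the sum over
midpoints to be nonpositive at (u + v)/2. If E becomes convex after division by a positive function
of u, summing its convexity inequality gives this.

Conversely, repeated entries act as rational weights, so separation of convex sets turns the
implication between sums into one inequality E((x + y)/2, (u + v)/2) ≤ a E(x, u) + b E(y, v), with
a, b depending only on u, v (`exists_midpoint_le`). For u = v it yields midpoint convexity in x, and
the sign condition supplies the local bound that upgrades this to convexity; one-sided derivatives p
(right) and m (left) then exist on the diagonal and are positive.

Differentiating at the diagonal, with w = (u + v)/2, gives p(w)/2 ≤ a p(u) and a m(u) ≤ m(w)/2.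
Hence p/m at a midpoint is at most p/m at either endpoint, which makes it constant by reflection and
connectedness. The two bounds then coincide, a = p(w)/(2p(u)) and b = p(w)/(2p(v)), and the
inequality becomes midpoint convexity of E/p. -/

open Filter Topology

/-! ### Midpoint convexity plus an upper bound -/

/-- A midpoint convex function on `[0, 1]` that is bounded above and nonpositive at the endpoints
is nonpositive. -/
theorem nonpos_of_midpoint_convex_unitInterval {g : ℝ → ℝ}
    (hmid : ∀ s ∈ Icc (0 : ℝ) 1, ∀ t ∈ Icc (0 : ℝ) 1, g ((s + t) / 2) ≤ (g s + g t) / 2)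
    (h0 : g 0 ≤ 0) (h1 : g 1 ≤ 0) {M : ℝ} (hM : ∀ s ∈ Icc (0 : ℝ) 1, g s ≤ M)
    {s : ℝ} (hs : s ∈ Icc (0 : ℝ) 1) : g s ≤ 0 := by
  have key : ∀ n : ℕ, ∀ s ∈ Icc (0 : ℝ) 1, g s ≤ |M| * (1 / 2) ^ n := by
    intro n
    induction n with
    | zero => intro s hs; simpa using (hM s hs).trans (le_abs_self M)
    | succ n ih =>
      intro s hs
      rw [pow_succ]
      -- The point s is the midpoint of its nearer endpoint and 2s or 2s - 1; as the endpoint value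
      -- is ≤ 0, the upper bound halves.
      rcases le_total s (1 / 2) with h | h
      · have hs' : 2 * s ∈ Icc (0 : ℝ) 1 := ⟨by linarith [hs.1], by linarith⟩
        have h2 := hmid 0 (by simp) (2 * s) hs'
        rw [show (0 + 2 * s) / 2 = s by ring] at h2
        linarith [ih _ hs']
      · have hs' : 2 * s - 1 ∈ Icc (0 : ℝ) 1 := ⟨by linarith, by linarith [hs.2]⟩
        have h2 := hmid 1 (by simp) (2 * s - 1) hs'
        rw [show (1 + (2 * s - 1)) / 2 = s by ring] at h2
        linarith [ih _ hs']
  have hlim : Tendsto (fun n : ℕ => |M| * (1 / 2 : ℝ) ^ n) atTop (𝓝 (|M| * 0)) :=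
    (tendsto_pow_atTop_nhds_zero_of_lt_one (by norm_num) (by norm_num)).const_mul _
  rw [mul_zero] at hlim
  exact ge_of_tendsto' hlim fun n => key n s hs

/-- A midpoint convex function that is bounded above on segments is convex. -/
theorem convexOn_of_midpoint_le {V : Type*} [AddCommGroup V] [Module ℝ V] {S : Set V} {F : V → ℝ}
    (hS : Convex ℝ S)
    (hmid : ∀ x ∈ S, ∀ y ∈ S, F ((1 / 2 : ℝ) • (x + y)) ≤ (F x + F y) / 2)
    (hbdd : ∀ x ∈ S, ∀ y ∈ S, ∃ M, ∀ z ∈ segment ℝ x y, F z ≤ M) : ConvexOn ℝ S F := by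
  refine ⟨hS, fun x hx y hy a b ha hb hab => ?_⟩
  obtain ⟨M, hM⟩ := hbdd x hx y hy
  have hseg : ∀ t ∈ Icc (0 : ℝ) 1, (1 - t) • x + t • y ∈ segment ℝ x y := fun t ht =>
    ⟨1 - t, t, by linarith [ht.2], ht.1, by ring, rfl⟩
  have key := nonpos_of_midpoint_convex_unitInterval
    (g := fun t => F ((1 - t) • x + t • y) - ((1 - t) * F x + t * F y)) (M := M + |F x| + |F y|)
    (s := b) ?_ (by simp) (by simp) ?_ ⟨hb, by linarith⟩
  · rw [show (1 - b) = a by linarith] at key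
    simpa using key
  · intro s hs t ht
    have h := hmid _ (hS.segment_subset hx hy (hseg s hs)) _ (hS.segment_subset hx hy (hseg t ht))
    rw [show (1 / 2 : ℝ) • ((1 - s) • x + s • y + ((1 - t) • x + t • y)) =
      (1 - (s + t) / 2) • x + ((s + t) / 2) • y by module] at h
    linarith
  · intro s hs
    have h1 := hM _ (hseg s hs)
    have h2 : -|F x| ≤ (1 - s) * F x := by
      nlinarith [neg_abs_le (F x), abs_nonneg (F x), hs.1, hs.2]
    have h3 : -|F y| ≤ s * F y := by
      nlinarith [neg_abs_le (F y), abs_nonneg (F y), hs.1, hs.2]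
    linarith

/-! ### Separation argument for finite sums -/

/-- A Farkas type lemma: if every finite sum of the vectors `(A i, B i, C i)` with negative first
two coordinates has a nonpositive third one, then `C` is bounded by a combination of `A`, `B`. -/
theorem exists_linear_majorant_of_finite_sums {ι : Type*} (A B C : ι → ℝ)
    (hneg : ∃ i, A i < 0 ∧ B i < 0)
    (h : ∀ (κ : Type) [Fintype κ] (z : κ → ι), ∑ k, A (z k) < 0 → ∑ k, B (z k) < 0 →
      ∑ k, C (z k) ≤ 0) :
    ∃ a b : ℝ, ∀ i, C i ≤ a * A i + b * B i := by
  let P : ι → ℝ × ℝ × ℝ := fun i => (A i, B i, C i)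
  let O : Set (ℝ × ℝ × ℝ) := Iio 0 ×ˢ (Iio 0 ×ˢ Ioi 0)
  have hOconv : Convex ℝ O := (convex_Iio 0).prod ((convex_Iio 0).prod (convex_Ioi 0))
  have hOopen : IsOpen O := isOpen_Iio.prod (isOpen_Iio.prod isOpen_Ioi)
  -- A convex combination in the open octant O stays there after rounding its weights to multiples
  -- of 1/N; multiplied by N, it is a finite sum with repetitions, excluded by `h`.
  have hdisj : Disjoint O (convexHull ℝ (range P)) := by
    refine Set.disjoint_left.2 fun q hq hq' => ?_
    obtain ⟨κ, _, w, p, hw0, -, hp, rfl⟩ := mem_convexHull_iff_exists_fintype.1 hq'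
    choose z hz using hp
    obtain rfl : (fun k => P (z k)) = p := funext hz
    have hq1 : ∑ k, w k * A (z k) < 0 := by
      have := hq.1
      simpa [P, Prod.fst_sum] using this
    have hq2 : ∑ k, w k * B (z k) < 0 := by
      have := hq.2.1
      simpa [P, Prod.fst_sum, Prod.snd_sum] using this
    have hq3 : 0 < ∑ k, w k * C (z k) := by
      have := hq.2.2
      simpa [P, Prod.fst_sum, Prod.snd_sum] using this
    have hlim : ∀ D : ι → ℝ, Tendsto (fun N : ℕ => ∑ k, (⌊w k * N⌋₊ / N : ℝ) * D (z k)) atTop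
        (𝓝 (∑ k, w k * D (z k))) := fun D => by
      refine tendsto_finsetSum _ fun k _ => Tendsto.mul_const _ ?_
      exact (tendsto_nat_floor_mul_div_atTop (hw0 k)).comp tendsto_natCast_atTop_atTop
    obtain ⟨N, ⟨⟨h1, h2⟩, h3⟩, hN⟩ := ((((hlim A).eventually (gt_mem_nhds hq1)).and
      ((hlim B).eventually (gt_mem_nhds hq2))).and ((hlim C).eventually (lt_mem_nhds hq3))).and
      (eventually_gt_atTop 0) |>.exists
    have hN' : (0 : ℝ) < N := Nat.cast_pos.2 hN
    have hsum : ∀ D : ι → ℝ, ∑ k : (Σ k, Fin ⌊w k * N⌋₊), D (z k.1) =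
        N * ∑ k, (⌊w k * N⌋₊ / N : ℝ) * D (z k) := fun D => by
      rw [Fintype.sum_sigma, Finset.mul_sum]
      refine Finset.sum_congr rfl fun k _ => ?_
      simp only [Finset.sum_const, Finset.card_univ, Fintype.card_fin, nsmul_eq_mul]
      field_simp
    have := h (Σ k, Fin ⌊w k * N⌋₊) (fun k => z k.1)
      (by rw [hsum]; exact mul_neg_of_pos_of_neg hN' h1)
      (by rw [hsum]; exact mul_neg_of_pos_of_neg hN' h2)
    rw [hsum] at this
    exact this.not_gt (mul_pos hN' h3)
  obtain ⟨f, s, hfO, hfP⟩ := geometric_hahn_banach_open hOconv hOopen (convex_convexHull ℝ _) hdisj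
  set α := f (1, 0, 0)
  set β := f (0, 1, 0)
  set γ := f (0, 0, 1)
  have hf : ∀ x y z : ℝ, f (x, y, z) = x * α + y * β + z * γ := fun x y z => by
    have : ((x, y, z) : ℝ × ℝ × ℝ) = x • (1, 0, 0) + y • (0, 1, 0) + z • (0, 0, 1) := by simp
    rw [this, map_add, map_add, map_smul, map_smul, map_smul]
    rfl
  have hO : ∀ x y z : ℝ, 0 < x → 0 < y → 0 < z → -x * α - y * β + z * γ < s := fun x y z hx hy hz => by
    have := hfO (-x, -y, z) ⟨neg_lt_zero.2 hx, neg_lt_zero.2 hy, hz⟩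
    rw [hf] at this
    linarith
  have hP : ∀ i, s ≤ A i * α + B i * β + C i * γ := fun i => by
    have := hfP _ (subset_convexHull ℝ _ ⟨i, rfl⟩)
    rwa [hf] at this
  -- O is a cone: a positive value of the form on its closure would grow past s under scaling.
  have hO' : ∀ x y z : ℝ, 0 ≤ x → 0 ≤ y → 0 ≤ z → -x * α - y * β + z * γ ≤ 0 := by
    intro x y z hx hy hz
    by_contra! hpos
    have hlin : Tendsto (fun t : ℝ => t * (-x * α - y * β + z * γ) + (-α - β + γ)) atTop atTop :=
      tendsto_atTop_add_const_right _ _ (tendsto_id.atTop_mul_const hpos)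
    obtain ⟨t, ht, ht0⟩ := ((hlin.eventually_ge_atTop s).and (eventually_ge_atTop 0)).exists
    have := hO (t * x + 1) (t * y + 1) (t * z + 1) (by positivity) (by positivity) (by positivity)
    linarith
  have hα : 0 ≤ α := by simpa using hO' 1 0 0
  have hβ : 0 ≤ β := by simpa using hO' 0 1 0
  have hγ : γ ≤ 0 := by simpa using hO' 0 0 1
  have hs : 0 ≤ s := by
    have hlim : Tendsto (fun t : ℝ => -t * α - t * β + t * γ) (𝓝[>] 0) (𝓝 (-0 * α - 0 * β + 0 * γ)) :=
      (Continuous.tendsto (by fun_prop) 0).mono_left nhdsWithin_le_nhds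
    have := le_of_tendsto hlim
      (eventually_nhdsWithin_of_forall fun t (ht : 0 < t) => (hO t t t ht ht ht).le)
    simpa using this
  obtain ⟨i₀, hA, hB⟩ := hneg
  -- The index from `hneg` is a Slater point: if γ = 0, it forces α = β = 0, against strict
  -- separation. So one may divide by -γ.
  have hγ' : γ < 0 := by
    refine hγ.lt_of_ne fun h0 => ?_
    have h1 := hP i₀
    have h2 := hO 1 1 1 one_pos one_pos one_pos
    rw [h0] at h1 h2
    have h3 : A i₀ * α ≤ 0 := mul_nonpos_of_nonpos_of_nonneg hA.le hα
    have h4 : B i₀ * β ≤ 0 := mul_nonpos_of_nonpos_of_nonneg hB.le hβ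
    have h5 : α = 0 := (mul_eq_zero.1 (by linarith : A i₀ * α = 0)).resolve_left hA.ne
    have h6 : β = 0 := (mul_eq_zero.1 (by linarith : B i₀ * β = 0)).resolve_left hB.ne
    rw [h5, h6] at h2
    linarith
  refine ⟨α / -γ, β / -γ, fun i => ?_⟩
  have h1 := hP i
  rw [div_mul_eq_mul_div, div_mul_eq_mul_div, ← add_div, le_div_iff₀ (neg_pos.2 hγ')]
  linarith

/-! ### Comparing the mean with a point; sufficiency of the convexity conditions -/

theorem half_add_mem {I : Set ℝ} (hI : I.OrdConnected) {s t : ℝ} (hs : s ∈ I) (ht : t ∈ I) :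
    (s + t) / 2 ∈ I := by
  have := hI.convex hs ht (by norm_num : (0 : ℝ) ≤ 1 / 2) (by norm_num : (0 : ℝ) ≤ 1 / 2)
    (by norm_num)
  rwa [smul_eq_mul, smul_eq_mul, ← mul_add, one_div_mul_eq_div] at this

namespace IsQuasideviation

variable {I : Set ℝ} {E : ℝ → ℝ → ℝ}

/-- If the sign at w were wrong, the intermediate value theorem between w and the largest or
smallest entry would produce a second zero. -/
theorem mean_le_iff (hI : I.OrdConnected) (hE : IsQuasideviation I E) {n : ℕ} (hn : 1 ≤ n)
    {x : Fin n → ℝ} (hx : ∀ i, x i ∈ I) {w : ℝ} (hw : w ∈ I) :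
    quasideviationMean I E n x ≤ w ↔ ∑ i, E (x i) w ≤ 0 := by
  have : Nonempty (Fin n) := ⟨⟨0, hn⟩⟩
  obtain ⟨hD, hFD⟩ := hE.mean_spec hI hn hx
  have hcont : ∀ a ∈ I, ∀ b ∈ I, ContinuousOn (fun u => ∑ i, E (x i) u) (Icc a b) :=
    fun a ha b hb => continuousOn_finsetSum _ fun i _ =>
      (hE.continuousOn (x i) (hx i)).mono (hI.out ha hb)
  constructor
  · intro hle
    by_contra! hpos
    have hlt : quasideviationMean I E n x < w := hle.lt_of_ne fun h => by
      rw [h] at hFD; exact hpos.ne' hFD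
    obtain ⟨b, hb⟩ := Finite.exists_max x
    have hwb : w ≤ x b := by
      by_contra! h
      exact hpos.not_ge (Finset.sum_nonpos fun i _ => hE.nonpos (hx i) hw ((hb i).trans h.le))
    obtain ⟨c, hc, hFc⟩ := intermediate_value_Icc' hwb (hcont w hw _ (hx b))
      ⟨Finset.sum_nonpos fun i _ => hE.nonpos (hx i) (hx b) (hb i), hpos.le⟩
    exact hE.not_two_zeros hn hx hD (hI.out hw (hx b) hc) hFD hFc (hlt.trans_le hc.1)
  · intro hle
    by_contra! hlt
    obtain ⟨a, ha⟩ := Finite.exists_min x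
    have haw : x a ≤ w := by
      by_contra! h
      exact hle.not_gt (Finset.sum_pos (fun i _ => hE.pos (hx i) hw (h.trans_le (ha i)))
        Finset.univ_nonempty)
    obtain ⟨c, hc, hFc⟩ := intermediate_value_Icc' haw (hcont _ (hx a) w hw)
      ⟨hle, Finset.sum_nonneg fun i _ => hE.nonneg (hx i) (hx a) (ha i)⟩
    exact hE.not_two_zeros hn hx (hI.out (hx a) hw hc) hD hFc hFD (hc.2.trans_lt hlt)

/-- If `E` becomes convex after division by a positive function of the second variable, then the
mean is Jensen convex. -/
theorem isJensenConvexMean_of_convexOn_div (hI : I.OrdConnected) (hE : IsQuasideviation I E)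
    {p : ℝ → ℝ} (hp : ∀ u ∈ I, 0 < p u)
    (hconv : ConvexOn ℝ (I ×ˢ I) (fun q : ℝ × ℝ => E q.1 q.2 / p q.2)) :
    IsJensenConvexMean I (quasideviationMean I E) := by
  intro n hn x y hx hy
  obtain ⟨hu, hFu⟩ := hE.mean_spec hI hn hx
  obtain ⟨hv, hFv⟩ := hE.mean_spec hI hn hy
  set u := quasideviationMean I E n x
  set v := quasideviationMean I E n y
  rw [hE.mean_le_iff hI hn (fun i => half_add_mem hI (hx i) (hy i)) (half_add_mem hI hu hv)]
  have hpw := hp _ (half_add_mem hI hu hv)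
  have hterm : ∀ i, E ((x i + y i) / 2) ((u + v) / 2) / p ((u + v) / 2) ≤
      1 / 2 * (E (x i) u / p u) + 1 / 2 * (E (y i) v / p v) := fun i => by
    have := hconv.2 (mk_mem_prod (hx i) hu) (mk_mem_prod (hy i) hv)
      (by norm_num : (0 : ℝ) ≤ 1 / 2) (by norm_num : (0 : ℝ) ≤ 1 / 2) (by norm_num)
    simp only [Prod.smul_mk, Prod.mk_add_mk, smul_eq_mul] at this
    rw [show (x i + y i) / 2 = 1 / 2 * x i + 1 / 2 * y i by ring,
      show (u + v) / 2 = 1 / 2 * u + 1 / 2 * v by ring]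
    exact this
  have hsum := Finset.sum_le_sum fun i (_ : i ∈ Finset.univ) => hterm i
  rw [Finset.sum_add_distrib, ← Finset.mul_sum, ← Finset.mul_sum, ← Finset.sum_div,
    ← Finset.sum_div, ← Finset.sum_div, hFu, hFv, zero_div, zero_div, mul_zero, add_zero,
    div_le_iff₀ hpw, zero_mul] at hsum
  exact hsum

end IsQuasideviation

/-! ### Monotonicity from sign and midpoint convexity; signs of one-sided derivatives -/

theorem exists_mem_lt {I : Set ℝ} (hI : IsOpen I) {u : ℝ} (hu : u ∈ I) : ∃ x ∈ I, x < u := by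
  obtain ⟨l, hl, hlI⟩ := exists_Ioc_subset_of_mem_nhds (hI.mem_nhds hu) ⟨u - 1, by linarith⟩
  exact ⟨(l + u) / 2, hlI ⟨by linarith, by linarith⟩, by linarith⟩

theorem exists_mem_gt {I : Set ℝ} (hI : IsOpen I) {u : ℝ} (hu : u ∈ I) : ∃ x ∈ I, u < x := by
  obtain ⟨l, hl, hlI⟩ := exists_Ico_subset_of_mem_nhds (hI.mem_nhds hu) ⟨u + 1, by linarith⟩
  exact ⟨(l + u) / 2, hlI ⟨by linarith, by linarith⟩, by linarith⟩

/-- A midpoint convex function on an open interval that is nonpositive to the left of `u` and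
nonnegative to the right of `u` is monotone to the right of `u`. -/
theorem monotoneOn_of_midpoint_convex {I : Set ℝ} (hopen : IsOpen I) (hI : I.OrdConnected)
    {f : ℝ → ℝ} {u : ℝ} (hu : u ∈ I)
    (hmid : ∀ x ∈ I, ∀ y ∈ I, f ((x + y) / 2) ≤ (f x + f y) / 2)
    (hleft : ∀ x ∈ I, x ≤ u → f x ≤ 0) (hright : ∀ x ∈ I, u ≤ x → 0 ≤ f x) :
    MonotoneOn f (I ∩ Ici u) := by
  rintro x ⟨hxI, hux⟩ y ⟨hyI, -⟩ hxy
  by_contra! hlt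
  have hxy : x < y := hxy.lt_of_ne fun h => hlt.ne' (h ▸ rfl)
  obtain ⟨l, hlI, hl⟩ := exists_mem_lt hopen hu
  -- Bisection: a strict drop of f from left to right survives on one of the two halves, so it
  -- occurs at arbitrarily small distance.
  have gap : ∀ n : ℕ, ∃ x' y', x ≤ x' ∧ y' ≤ y ∧ y' - x' = (y - x) * (1 / 2) ^ n ∧ f y' < f x' := by
    intro n
    induction n with
    | zero => exact ⟨x, y, le_rfl, le_rfl, by simp, hlt⟩
    | succ n ih =>
      obtain ⟨x', y', hx', hy', hd, hf⟩ := ih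
      have hpos : 0 < y' - x' := by rw [hd]; exact mul_pos (by linarith) (by positivity)
      have hm := hmid x' (hI.out hxI hyI ⟨hx', by linarith⟩) y' (hI.out hxI hyI ⟨by linarith, hy'⟩)
      have hd' : (y - x) * (1 / 2) ^ (n + 1) = (y' - x') / 2 := by rw [hd]; ring
      rw [hd']
      rcases lt_or_ge (f ((x' + y') / 2)) (f x') with h | h
      · exact ⟨x', (x' + y') / 2, hx', by linarith, by ring, h⟩
      · exact ⟨(x' + y') / 2, y', by linarith, hy', by ring, by linarith⟩
  have hlim : Tendsto (fun n : ℕ => (y - x) * (1 / 2 : ℝ) ^ n) atTop (𝓝 ((y - x) * 0)) :=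
    (tendsto_pow_atTop_nhds_zero_of_lt_one (by norm_num) (by norm_num)).const_mul _
  rw [mul_zero] at hlim
  obtain ⟨n, hn⟩ := (hlim.eventually (gt_mem_nhds (sub_pos.2 hl))).exists
  obtain ⟨x', y', hx', hy', hd, hf⟩ := gap n
  have hdpos : 0 < y' - x' := by rw [hd]; exact mul_pos (by linarith) (by positivity)
  rw [← hd] at hn
  set d := y' - x' with hd_def
  have hux' : u ≤ x' := le_trans hux hx'
  have hmem : ∀ z, l ≤ z → z ≤ y → z ∈ I := fun z h1 h2 => hI.out hlI hyI ⟨h1, h2⟩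
  -- By midpoint convexity the drop propagates leftwards in steps of d, so f keeps growing and stays
  -- positive.
  have hchain : ∀ k : ℕ, l ≤ x' - k * d →
      0 < f (x' - k * d) ∧ f (x' - k * d + d) < f (x' - k * d) := by
    intro k
    induction k with
    | zero =>
      intro _
      have h1 : x' + d = y' := by rw [hd_def]; ring
      have h2 := hright y' (hmem _ (by linarith) hy') (by linarith)
      simp only [Nat.cast_zero, zero_mul, sub_zero, h1]
      exact ⟨h2.trans_lt hf, hf⟩
    | succ k ih =>
      intro hk
      push_cast at hk ⊢
      have hkd : 0 ≤ (k : ℝ) * d := by positivity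
      obtain ⟨h1, h2⟩ := ih (by linarith)
      have h3 := hmid (x' - (k + 1) * d) (hmem _ hk (by linarith)) (x' - k * d + d)
        (hmem _ (by linarith) (by linarith))
      rw [show (x' - (k + 1) * d + (x' - k * d + d)) / 2 = x' - k * d by ring] at h3
      rw [show x' - (k + 1) * d + d = x' - k * d by ring]
      exact ⟨by linarith, by linarith⟩
  -- With this k, x' - k d lies in (u - d, u]; since d < u - l it is still right of l, and
  -- positivity there contradicts `hleft`.
  set k := ⌈(x' - u) / d⌉₊
  have hk1 : x' - u ≤ k * d := (div_le_iff₀ hdpos).1 (Nat.le_ceil _)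
  have hk2 : k * d < x' - u + d := by
    have := Nat.ceil_lt_add_one (div_nonneg (sub_nonneg.2 hux') hdpos.le)
    have := mul_lt_mul_of_pos_right this hdpos
    rwa [add_mul, div_mul_cancel₀ _ hdpos.ne', one_mul] at this
  have hlk : l ≤ x' - k * d := by linarith
  exact (hchain k hlk).1.not_ge (hleft _ (hmem _ hlk (by linarith)) (by linarith))

theorem nonneg_of_hasDerivWithinAt_Ioi {h : ℝ → ℝ} {u d : ℝ} (hd : HasDerivWithinAt h d (Ioi u) u)
    (hle : ∀ᶠ x in 𝓝[>] u, h u ≤ h x) : 0 ≤ d := by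
  refine ge_of_tendsto ((hasDerivWithinAt_iff_tendsto_slope' self_notMem_Ioi).1 hd) ?_
  filter_upwards [hle, self_mem_nhdsWithin] with x hx (hux : u < x)
  rw [slope_def_field]
  exact div_nonneg (sub_nonneg.2 hx) (sub_nonneg.2 hux.le)

theorem nonpos_of_hasDerivWithinAt_Iio {h : ℝ → ℝ} {u d : ℝ} (hd : HasDerivWithinAt h d (Iio u) u)
    (hle : ∀ᶠ x in 𝓝[<] u, h u ≤ h x) : d ≤ 0 := by
  refine le_of_tendsto ((hasDerivWithinAt_iff_tendsto_slope' self_notMem_Iio).1 hd) ?_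
  filter_upwards [hle, self_mem_nhdsWithin] with x hx (hux : x < u)
  rw [slope_def_field]
  exact div_nonpos_of_nonneg_of_nonpos (sub_nonneg.2 hx) (sub_nonpos.2 hux.le)

/-! ### From Jensen convexity to convexity in the first variable -/

namespace IsQuasideviation

variable {I : Set ℝ} {E : ℝ → ℝ → ℝ}

theorem sum_midpoint_nonpos (hI : I.OrdConnected) (hE : IsQuasideviation I E)
    (hJ : IsJensenConvexMean I (quasideviationMean I E)) {κ : Type*} [Fintype κ] [Nonempty κ]
    {x y : κ → ℝ} (hx : ∀ k, x k ∈ I) (hy : ∀ k, y k ∈ I) {u v : ℝ} (hu : u ∈ I) (hv : v ∈ I)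
    (hxu : ∑ k, E (x k) u ≤ 0) (hyv : ∑ k, E (y k) v ≤ 0) :
    ∑ k, E ((x k + y k) / 2) ((u + v) / 2) ≤ 0 := by
  let e := (Fintype.equivFin κ).symm
  have hn : 1 ≤ Fintype.card κ := Fintype.card_pos
  rw [← e.sum_comp] at hxu hyv ⊢
  rw [← hE.mean_le_iff hI hn (fun i => hx (e i)) hu] at hxu
  rw [← hE.mean_le_iff hI hn (fun i => hy (e i)) hv] at hyv
  rw [← hE.mean_le_iff hI hn (fun i => half_add_mem hI (hx (e i)) (hy (e i)))
    (half_add_mem hI hu hv)]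
  have := hJ _ hn _ _ (fun i => hx (e i)) (fun i => hy (e i))
  linarith

/-- The Farkas type lemma applied to vectors indexed by I × I; points left of u and v give the
negative index. -/
theorem exists_midpoint_le (hopen : IsOpen I) (hI : I.OrdConnected) (hE : IsQuasideviation I E)
    (hJ : IsJensenConvexMean I (quasideviationMean I E)) {u v : ℝ} (hu : u ∈ I) (hv : v ∈ I) :
    ∃ a b : ℝ, ∀ x ∈ I, ∀ y ∈ I,
      E ((x + y) / 2) ((u + v) / 2) ≤ a * E x u + b * E y v := by
  obtain ⟨x₀, hx₀, hxu⟩ := exists_mem_lt hopen hu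
  obtain ⟨y₀, hy₀, hyv⟩ := exists_mem_lt hopen hv
  obtain ⟨a, b, hab⟩ := exists_linear_majorant_of_finite_sums
    (fun q : I × I => E q.1 u) (fun q => E q.2 v) (fun q => E ((q.1 + q.2) / 2) ((u + v) / 2))
    ⟨(⟨x₀, hx₀⟩, ⟨y₀, hy₀⟩), hE.neg hx₀ hu hxu, hE.neg hy₀ hv hyv⟩
    (fun κ _ z h1 h2 => by
      have : Nonempty κ := by
        by_contra hemp
        rw [not_nonempty_iff] at hemp
        simp at h1
      exact hE.sum_midpoint_nonpos hI hJ (fun k => (z k).1.2) (fun k => (z k).2.2) hu hv h1.le h2.le)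
  exact ⟨a, b, fun x hx y hy => hab (⟨x, hx⟩, ⟨y, hy⟩)⟩

theorem midpoint_le (hopen : IsOpen I) (hI : I.OrdConnected) (hE : IsQuasideviation I E)
    (hJ : IsJensenConvexMean I (quasideviationMean I E)) {u : ℝ} (hu : u ∈ I) {x y : ℝ}
    (hx : x ∈ I) (hy : y ∈ I) : E ((x + y) / 2) u ≤ (E x u + E y u) / 2 := by
  obtain ⟨a, b, hab⟩ := hE.exists_midpoint_le hopen hI hJ hu hu
  rw [add_self_div_two] at hab
  obtain ⟨s, hs, hsu⟩ := exists_mem_lt hopen hu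
  obtain ⟨t, ht, hut⟩ := exists_mem_gt hopen hu
  have h1 := hab s hs s hs
  have h2 := hab t ht t ht
  rw [add_self_div_two] at h1 h2
  -- The inequality with x = y is tested where E(·, u) is negative and where it is positive.
  have h3 : a + b = 1 := by
    have hsE := hE.neg hs hu hsu
    have htE := hE.pos ht hu hut
    apply le_antisymm <;> by_contra! hlt <;> nlinarith
  have h4 := hab x hx y hy
  -- Adding the inequality with x and y exchanged replaces both coefficients by (a + b)/2 = 1/2.
  have h5 := hab y hy x hx
  rw [add_comm y x] at h5
  obtain rfl : b = 1 - a := by linarith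
  linarith

theorem convexOn_left (hopen : IsOpen I) (hI : I.OrdConnected) (hE : IsQuasideviation I E)
    (hJ : IsJensenConvexMean I (quasideviationMean I E)) {u : ℝ} (hu : u ∈ I) :
    ConvexOn ℝ I (fun x => E x u) := by
  have hmid : ∀ x ∈ I, ∀ y ∈ I, E ((x + y) / 2) u ≤ (E x u + E y u) / 2 := fun x hx y hy =>
    hE.midpoint_le hopen hI hJ hu hx hy
  have hmono := monotoneOn_of_midpoint_convex hopen hI hu hmid
    (fun x hx h => hE.nonpos hx hu h) (fun x hx h => hE.nonneg hx hu h)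
  refine convexOn_of_midpoint_le hI.convex (fun x hx y hy => ?_) fun x hx y hy => ?_
  · rw [smul_eq_mul, one_div_mul_eq_div]
    exact hmid x hx y hy
  · have hm : max x y ∈ I := max_rec' (· ∈ I) hx hy
    refine ⟨max 0 (E (max x y) u), fun z hz => ?_⟩
    have hzI := hI.convex.segment_subset hx hy hz
    rw [segment_eq_uIcc] at hz
    rcases le_total z u with h | h
    · exact (hE.nonpos hzI hu h).trans (le_max_left _ _)
    · exact (hmono ⟨hzI, h⟩ ⟨hm, h.trans hz.2⟩ hz.2).trans (le_max_right _ _)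

end IsQuasideviation

/-! ### One-sided derivatives on the diagonal -/

namespace IsQuasideviation

variable {I : Set ℝ} {E : ℝ → ℝ → ℝ}

theorem hasDerivWithinAt_rightDiagDeriv (hopen : IsOpen I) {u : ℝ} (hu : u ∈ I)
    (hconv : ConvexOn ℝ I (fun x => E x u)) :
    HasDerivWithinAt (fun x => E x u) (rightDiagDeriv E u) (Ioi u) u :=
  hconv.hasDerivWithinAt_rightDeriv_of_mem_interior (hopen.interior_eq.symm ▸ hu)

theorem hasDerivWithinAt_leftDiagDeriv (hopen : IsOpen I) {u : ℝ} (hu : u ∈ I)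
    (hconv : ConvexOn ℝ I (fun x => E x u)) :
    HasDerivWithinAt (fun x => E x u) (leftDiagDeriv E u) (Iio u) u :=
  hconv.hasDerivWithinAt_leftDeriv_of_mem_interior (hopen.interior_eq.symm ▸ hu)

theorem div_le_leftDiagDeriv (hopen : IsOpen I) (hE : IsQuasideviation I E) {u : ℝ} (hu : u ∈ I)
    (hconv : ConvexOn ℝ I (fun x => E x u)) {x : ℝ} (hx : x ∈ I) (hxu : x < u) :
    E x u / (x - u) ≤ leftDiagDeriv E u := by
  have := hconv.slope_le_leftDeriv_of_mem_interior hx (hopen.interior_eq.symm ▸ hu) hxu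
  rwa [slope_comm, slope_def_field, hE.diag hu, sub_zero] at this

theorem leftDiagDeriv_le_rightDiagDeriv (hopen : IsOpen I) {u : ℝ} (hu : u ∈ I)
    (hconv : ConvexOn ℝ I (fun x => E x u)) : leftDiagDeriv E u ≤ rightDiagDeriv E u :=
  hconv.leftDeriv_le_rightDeriv_of_mem_interior (hopen.interior_eq.symm ▸ hu)

theorem leftDiagDeriv_pos (hopen : IsOpen I) (hE : IsQuasideviation I E) {u : ℝ} (hu : u ∈ I)
    (hconv : ConvexOn ℝ I (fun x => E x u)) : 0 < leftDiagDeriv E u := by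
  obtain ⟨x, hx, hxu⟩ := exists_mem_lt hopen hu
  exact (div_pos_of_neg_of_neg (hE.neg hx hu hxu) (sub_neg.2 hxu)).trans_le
    (hE.div_le_leftDiagDeriv hopen hu hconv hx hxu)

theorem rightDiagDeriv_pos (hopen : IsOpen I) (hE : IsQuasideviation I E) {u : ℝ} (hu : u ∈ I)
    (hconv : ConvexOn ℝ I (fun x => E x u)) : 0 < rightDiagDeriv E u :=
  (hE.leftDiagDeriv_pos hopen hu hconv).trans_le (leftDiagDeriv_le_rightDiagDeriv hopen hu hconv)

/-- The right derivative is a subgradient at u: to the left of u the slopes are at most the left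
derivative, hence at most the right one, and x - u < 0 reverses the inequality. -/
theorem rightDiagDeriv_mul_sub_le (hopen : IsOpen I) (hE : IsQuasideviation I E) {u : ℝ}
    (hu : u ∈ I) (hconv : ConvexOn ℝ I (fun x => E x u)) {x : ℝ} (hx : x ∈ I) :
    rightDiagDeriv E u * (x - u) ≤ E x u := by
  rcases lt_trichotomy x u with h | rfl | h
  · have h1 := (hE.div_le_leftDiagDeriv hopen hu hconv hx h).trans
      (leftDiagDeriv_le_rightDiagDeriv hopen hu hconv)
    rwa [div_le_iff_of_neg (sub_neg.2 h)] at h1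
  · rw [sub_self, mul_zero, hE.diag hu]
  · have := hconv.rightDeriv_le_slope_of_mem_interior (hopen.interior_eq.symm ▸ hu) hx h
    rwa [slope_def_field, hE.diag hu, sub_zero, le_div_iff₀ (sub_pos.2 h)] at this

/-- Differentiating the inequality `E((x + v) / 2, (u + v) / 2) ≤ a E(x, u)` at `x = u`. -/
theorem diagDeriv_half_le (hopen : IsOpen I) (hI : I.OrdConnected) (hE : IsQuasideviation I E)
    (hconv : ∀ u ∈ I, ConvexOn ℝ I (fun x => E x u)) {u v a : ℝ} (hu : u ∈ I) (hv : v ∈ I)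
    (ha : ∀ x ∈ I, E ((x + v) / 2) ((u + v) / 2) ≤ a * E x u) :
    rightDiagDeriv E ((u + v) / 2) / 2 ≤ a * rightDiagDeriv E u ∧
      a * leftDiagDeriv E u ≤ leftDiagDeriv E ((u + v) / 2) / 2 := by
  have hw := half_add_mem hI hu hv
  set w := (u + v) / 2 with hw_def
  have hin : ∀ s : Set ℝ, HasDerivWithinAt (fun x : ℝ => (x + v) / 2) (1 / 2) s u := fun s =>
    ((hasDerivWithinAt_id u s).add_const v).div_const 2
  have hle : ∀ᶠ x in 𝓝 u, a * E u u - E ((u + v) / 2) w ≤ a * E x u - E ((x + v) / 2) w := by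
    filter_upwards [hopen.mem_nhds hu] with x hx
    rw [← hw_def, hE.diag hu, hE.diag hw]
    linarith [ha x hx]
  constructor
  · have h1 := (hasDerivWithinAt_rightDiagDeriv hopen hu (hconv u hu)).const_mul a
    have h2 := HasDerivWithinAt.comp u (h := fun x : ℝ => (x + v) / 2)
      (hasDerivWithinAt_rightDiagDeriv hopen hw (hconv w hw)) (hin (Ioi u))
      (fun x (hx : u < x) => show w < (x + v) / 2 by rw [hw_def]; linarith)
    have := nonneg_of_hasDerivWithinAt_Ioi (h1.sub h2) (hle.filter_mono nhdsWithin_le_nhds)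
    linarith
  · have h1 := (hasDerivWithinAt_leftDiagDeriv hopen hu (hconv u hu)).const_mul a
    have h2 := HasDerivWithinAt.comp u (h := fun x : ℝ => (x + v) / 2)
      (hasDerivWithinAt_leftDiagDeriv hopen hw (hconv w hw)) (hin (Iio u))
      (fun x (hx : x < u) => show (x + v) / 2 < w by rw [hw_def]; linarith)
    have := nonpos_of_hasDerivWithinAt_Iio (h1.sub h2) (hle.filter_mono nhdsWithin_le_nhds)
    linarith

theorem exists_midpoint_le_and_diagDeriv_half_le (hopen : IsOpen I) (hI : I.OrdConnected)
    (hE : IsQuasideviation I E) (hJ : IsJensenConvexMean I (quasideviationMean I E))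
    {u v : ℝ} (hu : u ∈ I) (hv : v ∈ I) :
    ∃ a b : ℝ, (∀ x ∈ I, ∀ y ∈ I, E ((x + y) / 2) ((u + v) / 2) ≤ a * E x u + b * E y v) ∧
      (rightDiagDeriv E ((u + v) / 2) / 2 ≤ a * rightDiagDeriv E u ∧
        a * leftDiagDeriv E u ≤ leftDiagDeriv E ((u + v) / 2) / 2) ∧
      (rightDiagDeriv E ((u + v) / 2) / 2 ≤ b * rightDiagDeriv E v ∧
        b * leftDiagDeriv E v ≤ leftDiagDeriv E ((u + v) / 2) / 2) := by
  obtain ⟨a, b, hab⟩ := hE.exists_midpoint_le hopen hI hJ hu hv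
  have hconv : ∀ u ∈ I, ConvexOn ℝ I (fun x => E x u) := fun u hu =>
    hE.convexOn_left hopen hI hJ hu
  refine ⟨a, b, hab, hE.diagDeriv_half_le hopen hI hconv hu hv fun x hx => ?_, ?_⟩
  · have := hab x hx v hv
    rwa [hE.diag hv, mul_zero, add_zero] at this
  · rw [add_comm u v]
    refine hE.diagDeriv_half_le hopen hI hconv hv hu fun y hy => ?_
    have := hab u hu y hy
    rwa [hE.diag hu, mul_zero, zero_add, add_comm u y, add_comm u v] at this

/-- Eliminating a from the two derivative inequalities shows that the ratio at a midpoint is at most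
the ratio at an endpoint. For nearby x, y each is the midpoint of the other and a reflected point of
I, so the ratio is locally constant. -/
theorem exists_rightDiagDeriv_eq_mul (hopen : IsOpen I) (hI : I.OrdConnected)
    (hE : IsQuasideviation I E) (hJ : IsJensenConvexMean I (quasideviationMean I E)) :
    ∃ c : ℝ, 0 < c ∧ ∀ u ∈ I, rightDiagDeriv E u = c * leftDiagDeriv E u := by
  have hm : ∀ u ∈ I, 0 < leftDiagDeriv E u := fun u hu =>
    hE.leftDiagDeriv_pos hopen hu (hE.convexOn_left hopen hI hJ hu)
  have hp : ∀ u ∈ I, 0 < rightDiagDeriv E u := fun u hu =>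
    hE.rightDiagDeriv_pos hopen hu (hE.convexOn_left hopen hI hJ hu)
  have hle : ∀ u ∈ I, ∀ w ∈ I, 2 * w - u ∈ I →
      rightDiagDeriv E w / leftDiagDeriv E w ≤ rightDiagDeriv E u / leftDiagDeriv E u := by
    intro u hu w hw hv
    obtain ⟨a, b, -, ⟨h1, h2⟩, -⟩ := hE.exists_midpoint_le_and_diagDeriv_half_le hopen hI hJ hu hv
    rw [show (u + (2 * w - u)) / 2 = w by ring] at h1 h2
    rw [div_le_div_iff₀ (hm w hw) (hm u hu)]
    have h3 := mul_le_mul_of_nonneg_right h1 (hm u hu).le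
    have h4 := mul_le_mul_of_nonneg_right h2 (hp u hu).le
    linarith
  rcases I.eq_empty_or_nonempty with rfl | ⟨u₀, hu₀⟩
  · exact ⟨1, one_pos, by simp⟩
  refine ⟨rightDiagDeriv E u₀ / leftDiagDeriv E u₀, div_pos (hp u₀ hu₀) (hm u₀ hu₀),
    fun u hu => ?_⟩
  rw [← div_eq_iff (hm u hu).ne']
  refine hI.isPreconnected.induction₂
    (fun u w => rightDiagDeriv E u / leftDiagDeriv E u = rightDiagDeriv E w / leftDiagDeriv E w)
    (fun x hx => ?_) (fun x y z _ _ _ h h' => h.trans h') (fun x y _ _ h => h.symm) hu hu₀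
  have h1 : ∀ᶠ y in 𝓝 x, 2 * y - x ∈ I :=
    ContinuousAt.eventually_mem (f := fun y => 2 * y - x) (by fun_prop)
      (hopen.mem_nhds (by rwa [two_mul, add_sub_cancel_right]))
  have h2 : ∀ᶠ y in 𝓝 x, 2 * x - y ∈ I :=
    ContinuousAt.eventually_mem (f := fun y => 2 * x - y) (by fun_prop)
      (hopen.mem_nhds (by rwa [two_mul, add_sub_cancel_right]))
  filter_upwards [h1.filter_mono nhdsWithin_le_nhds, h2.filter_mono nhdsWithin_le_nhds,
    self_mem_nhdsWithin] with y hy1 hy2 hy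
  exact le_antisymm (hle y hy x hx hy2) (hle x hx y hy hy1)

/-! ### Joint convexity and continuity of the normalization -/

theorem div_rightDiagDeriv_midpoint_le (hopen : IsOpen I) (hI : I.OrdConnected)
    (hE : IsQuasideviation I E) (hJ : IsJensenConvexMean I (quasideviationMean I E))
    {x y u v : ℝ} (hx : x ∈ I) (hy : y ∈ I) (hu : u ∈ I) (hv : v ∈ I) :
    E ((x + y) / 2) ((u + v) / 2) / rightDiagDeriv E ((u + v) / 2) ≤
      (E x u / rightDiagDeriv E u + E y v / rightDiagDeriv E v) / 2 := by
  have hp : ∀ u ∈ I, 0 < rightDiagDeriv E u := fun u hu =>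
    hE.rightDiagDeriv_pos hopen hu (hE.convexOn_left hopen hI hJ hu)
  obtain ⟨c, hc, hpm⟩ := hE.exists_rightDiagDeriv_eq_mul hopen hI hJ
  obtain ⟨a, b, hab, ⟨ha1, ha2⟩, hb1, hb2⟩ :=
    hE.exists_midpoint_le_and_diagDeriv_half_le hopen hI hJ hu hv
  have hw := half_add_mem hI hu hv
  have hxy := hab x hx y hy
  set w := (u + v) / 2
  have ha : a * rightDiagDeriv E u = rightDiagDeriv E w / 2 := by
    refine le_antisymm ?_ ha1
    rw [hpm u hu, hpm w hw]
    linarith [mul_le_mul_of_nonneg_left ha2 hc.le]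
  have hb : b * rightDiagDeriv E v = rightDiagDeriv E w / 2 := by
    refine le_antisymm ?_ hb1
    rw [hpm v hv, hpm w hw]
    linarith [mul_le_mul_of_nonneg_left hb2 hc.le]
  rw [← eq_div_iff (hp u hu).ne'] at ha
  rw [← eq_div_iff (hp v hv).ne'] at hb
  rw [div_le_iff₀ (hp w hw)]
  refine hxy.trans_eq ?_
  rw [ha, hb]
  ring

theorem convexOn_div_rightDiagDeriv (hopen : IsOpen I) (hI : I.OrdConnected)
    (hE : IsQuasideviation I E) (hJ : IsJensenConvexMean I (quasideviationMean I E)) :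
    ConvexOn ℝ (I ×ˢ I) (fun q : ℝ × ℝ => E q.1 q.2 / rightDiagDeriv E q.2) := by
  have hconv : ∀ u ∈ I, ConvexOn ℝ I (fun x => E x u) := fun u hu =>
    hE.convexOn_left hopen hI hJ hu
  refine convexOn_of_midpoint_le (hI.convex.prod hI.convex) ?_ ?_
  · rintro ⟨x, u⟩ ⟨hx, hu⟩ ⟨y, v⟩ ⟨hy, hv⟩
    simp only [Prod.mk_add_mk, Prod.smul_mk, smul_eq_mul, one_div_mul_eq_div]
    exact hE.div_rightDiagDeriv_midpoint_le hopen hI hJ hx hy hu hv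
  · rintro ⟨x, u⟩ ⟨hx, hu⟩ ⟨y, v⟩ ⟨hy, hv⟩
    have hsub : uIcc u v ⊆ I := hI.uIcc_subset hu hv
    have hmin : min u v ∈ I := min_rec' (· ∈ I) hu hv
    -- Continuity of the right derivative is not yet known, so it is bounded below by the slopes
    -- E(x₀, w)/(x₀ - w) with x₀ left of all w: these are positive and continuous on a compact
    -- interval. The numerator is bounded by its values at the two endpoints x, y.
    obtain ⟨x₀, hx₀, hx₀u⟩ := exists_mem_lt hopen hmin
    have hlt : ∀ w ∈ uIcc u v, x₀ < w := fun w hw => hx₀u.trans_le hw.1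
    obtain ⟨w₁, hw₁, hmax⟩ := isCompact_uIcc.exists_isMaxOn nonempty_uIcc
      (((hE.continuousOn x hx).mono hsub).sup ((hE.continuousOn y hy).mono hsub))
    have hslope : ContinuousOn (fun w => E x₀ w / (x₀ - w)) (uIcc u v) :=
      ((hE.continuousOn x₀ hx₀).mono hsub).div (by fun_prop)
        fun w hw => (sub_neg.2 (hlt w hw)).ne
    obtain ⟨w₂, hw₂, hmin⟩ := isCompact_uIcc.exists_isMinOn nonempty_uIcc hslope
    have hδ : 0 < E x₀ w₂ / (x₀ - w₂) := div_pos_of_neg_of_neg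
      (hE.neg hx₀ (hsub hw₂) (hlt w₂ hw₂)) (sub_neg.2 (hlt w₂ hw₂))
    set K := max (E x w₁) (E y w₁)
    set δ := E x₀ w₂ / (x₀ - w₂)
    refine ⟨max K 0 / δ, ?_⟩
    rintro ⟨z, w⟩ ⟨a, b, ha, hb, hab, h⟩
    have hz : z ∈ segment ℝ x y := ⟨a, b, ha, hb, hab, congrArg Prod.fst h⟩
    have hw : w ∈ uIcc u v := by
      rw [← segment_eq_uIcc]
      exact ⟨a, b, ha, hb, hab, congrArg Prod.snd h⟩
    have hwI := hsub hw
    have h1 : E z w ≤ max K 0 :=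
      ((hconv w hwI).le_max_of_mem_segment hx hy hz).trans ((hmax hw).trans (le_max_left _ _))
    have h2 : δ ≤ rightDiagDeriv E w :=
      (hmin hw).trans ((hE.div_le_leftDiagDeriv hopen hwI (hconv w hwI) hx₀ (hlt w hw)).trans
        (leftDiagDeriv_le_rightDiagDeriv hopen hwI (hconv w hwI)))
    calc E z w / rightDiagDeriv E w ≤ max K 0 / rightDiagDeriv E w := by
          gcongr
          exact (hδ.trans_le h2).le
      _ ≤ max K 0 / δ := by gcongr

/-- For fixed x < u, the right derivative at w near u is the quotient of E(x, w) by the normalized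
function, both continuous in w and nonzero. -/
theorem continuousOn_rightDiagDeriv (hopen : IsOpen I) (hE : IsQuasideviation I E)
    (hp : ∀ u ∈ I, 0 < rightDiagDeriv E u)
    (hcont : ContinuousOn (fun q : ℝ × ℝ => E q.1 q.2 / rightDiagDeriv E q.2) (I ×ˢ I)) :
    ContinuousOn (rightDiagDeriv E) I := by
  intro u hu
  obtain ⟨x, hx, hxu⟩ := exists_mem_lt hopen hu
  have hne : E x u ≠ 0 := (hE.neg hx hu hxu).ne
  have h1 : ContinuousWithinAt (fun w => E x w / rightDiagDeriv E w) I u :=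
    ContinuousWithinAt.comp (f := fun w => (x, w)) (t := I ×ˢ I) (hcont (x, u) ⟨hx, hu⟩)
      (by fun_prop) fun w hw => ⟨hx, hw⟩
  have h2 := ((hE.continuousOn x hx) u hu).div h1 (div_ne_zero hne (hp u hu).ne')
  refine h2.congr_of_eventuallyEq_of_mem ?_ hu
  filter_upwards [self_mem_nhdsWithin,
    nhdsWithin_le_nhds (eventually_gt_nhds hxu)] with w hw hxw
  exact (div_div_cancel₀ (hE.neg hx hw hxw).ne).symm

end IsQuasideviation

/-! ### The equivalence and its consequences -/

theorem mainTheorem1 (I : Set ℝ) (hI_open : IsOpen I) (hI_interval : I.OrdConnected)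
    (hI_nonempty : I.Nonempty) (E : ℝ → ℝ → ℝ) (hE : IsQuasideviation I E) :
    List.TFAE
      [IsJensenConvexMean I (quasideviationMean I E),
        RightNormalizationConvex I E,
        LeftNormalizationConvex I E] ∧
    ((IsJensenConvexMean I (quasideviationMean I E) ∨ RightNormalizationConvex I E ∨
        LeftNormalizationConvex I E) →
      ContinuousOn (fun p : ℝ × ℝ => E p.1 p.2) (I ×ˢ I) ∧
      (∀ u ∈ I, ConvexOn ℝ I (fun x => E x u)) ∧
      ContinuousOn (fun u => (leftDiagDeriv E u, rightDiagDeriv E u)) I ∧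
      (∃ c : ℝ, ∀ u ∈ I, rightDiagDeriv E u / leftDiagDeriv E u = c) ∧
      (∀ n : ℕ, 1 ≤ n → ∀ x : Fin n → ℝ, (∀ i, x i ∈ I) →
        (∑ i, x i) / n ≤ quasideviationMean I E n x)) := by
  have hright : RightNormalizationConvex I E →
      IsJensenConvexMean I (quasideviationMean I E) := fun h =>
    hE.isJensenConvexMean_of_convexOn_div hI_interval (fun u hu => (h.1 u hu).2) h.2
  have hleft : LeftNormalizationConvex I E →
      IsJensenConvexMean I (quasideviationMean I E) := fun h =>
    hE.isJensenConvexMean_of_convexOn_div hI_interval (fun u hu => (h.1 u hu).2) h.2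
  refine ⟨?_, fun h => ?_⟩
  · tfae_have 2 → 1 := hright
    tfae_have 3 → 1 := hleft
    tfae_have 1 → 2 := fun hJ => by
      have hconv := fun u hu => hE.convexOn_left (u := u) hI_open hI_interval hJ hu
      exact ⟨fun u hu => ⟨(IsQuasideviation.hasDerivWithinAt_rightDiagDeriv hI_open hu
        (hconv u hu)).differentiableWithinAt, hE.rightDiagDeriv_pos hI_open hu (hconv u hu)⟩,
        hE.convexOn_div_rightDiagDeriv hI_open hI_interval hJ⟩
    tfae_have 1 → 3 := fun hJ => by
      have hconv := fun u hu => hE.convexOn_left (u := u) hI_open hI_interval hJ hu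
      refine ⟨fun u hu => ⟨(IsQuasideviation.hasDerivWithinAt_leftDiagDeriv hI_open hu
        (hconv u hu)).differentiableWithinAt, hE.leftDiagDeriv_pos hI_open hu (hconv u hu)⟩, ?_⟩
      obtain ⟨c, hc, hpm⟩ := hE.exists_rightDiagDeriv_eq_mul hI_open hI_interval hJ
      -- Since the right derivative is c times the left one, E⁻ = c E⁺ with c > 0.
      refine ((hE.convexOn_div_rightDiagDeriv hI_open hI_interval hJ).smul hc.le).congr ?_
      rintro ⟨x, u⟩ ⟨-, hu⟩
      have := (hE.leftDiagDeriv_pos hI_open hu (hconv u hu)).ne'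
      simp only [smul_eq_mul, hpm u hu]
      field_simp
    tfae_finish
  · have hJ : IsJensenConvexMean I (quasideviationMean I E) := by
      rcases h with h | h | h
      exacts [h, hright h, hleft h]
    have hconv := fun u hu => hE.convexOn_left (u := u) hI_open hI_interval hJ hu
    have hp := fun u hu => hE.rightDiagDeriv_pos hI_open hu (hconv u hu)
    have hm := fun u hu => hE.leftDiagDeriv_pos hI_open hu (hconv u hu)
    have hcont := (hE.convexOn_div_rightDiagDeriv hI_open hI_interval hJ).continuousOn
      (hI_open.prod hI_open)
    have hpcont := hE.continuousOn_rightDiagDeriv hI_open hp hcont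
    obtain ⟨c, hc, hpm⟩ := hE.exists_rightDiagDeriv_eq_mul hI_open hI_interval hJ
    refine ⟨?_, hconv, ?_, ⟨c, fun u hu => ?_⟩, fun n hn x hx => ?_⟩
    · refine (hcont.mul (hpcont.comp continuousOn_snd fun q hq => hq.2)).congr ?_
      rintro ⟨x, u⟩ ⟨-, hu⟩
      exact (div_mul_cancel₀ _ (hp u hu).ne').symm
    · refine ContinuousOn.prodMk ((hpcont.div_const c).congr fun u hu => ?_) hpcont
      exact (by rw [hpm u hu, mul_div_cancel_left₀ _ hc.ne'] :
        leftDiagDeriv E u = rightDiagDeriv E u / c)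
    · rw [hpm u hu, mul_div_cancel_right₀ _ (hm u hu).ne']
    · obtain ⟨hD, hFD⟩ := hE.mean_spec hI_interval hn hx
      set u := quasideviationMean I E n x
      -- Summing the supporting-line bounds at the mean u, where the E(xᵢ, u) add up to 0, gives
      -- ∑(xᵢ - u) ≤ 0.
      have hsum := Finset.sum_le_sum fun i (_ : i ∈ Finset.univ) =>
        hE.rightDiagDeriv_mul_sub_le hI_open hD (hconv u hD) (hx i)
      rw [hFD, ← Finset.mul_sum, Finset.sum_sub_distrib, Finset.sum_const, Finset.card_univ,
        Fintype.card_fin, nsmul_eq_mul] at hsum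
      have := nonpos_of_mul_nonpos_right hsum (hp u hD)
      rw [div_le_iff₀ (by exact_mod_cast hn)]
      linarith
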